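/- Call a triangular array $f=(f_n(k))$ $(n\ge 1,\ 1\le k\le 2n-1)$ of rational numbers a solution of the finite difference system if $$\Delta^2 f_n(k)+4f_{n-1}(k)=0\qquad(n\ge 2,\ 1\le k\le 2n-3),$$ where $\Delta f_n(k)=f_n(k+1)-f_n(k)$. Let $(g_n(k))$ be the unique solution with $g_1(1)=1$ and, for $n\ge 2$, $g_n(1)=0$ and $g_n(2)=2\sum_{k=1}^{2n-3} g_{n-1}(k)$. Let $(h_n(k))$ be the unique solution with $h_1(1)=1$ and, for $n\ge 2$, $h_n(1)=\sum_{k=1}^{2n-3} h_{n-1}(k)$ and $h_n(2)=3\sum_{k=1}^{2n-3} h_{n-1}(k)$. Let the secant numbers $E_{2n}$ and the tangent numbers $T_{2n+1}$ be defined by $$\sec u=\sum_{n\ge 0}E_{2n}\frac{u^{2n}}{(2n)!},\qquad \tan u=\sum_{n\ge 0}T_{2n+1}\frac{u^{2n+1}}{(2n+1)!}.$$ Then, for every $n\ge 1$, $$\sum_{k=1}^{2n+1}\binom{2n}{k-1}g_{n+1}(k)=4^nE_{2n},\qquad \sum_{k=1}^{2n+1}(-1)^{k-1}\binom{2n}{k-1}g_{n+1}(k)=(-1)^n4^n,$$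 $$\sum_{k=1}^{2n+1}\binom{2n}{k-1}h_{n+1}(k)=4^nT_{2n+1},\qquad \sum_{k=1}^{2n+1}(-1)^{k-1}\binom{2n}{k-1}h_{n+1}(k)=(-1)^n4^n.$$ -/

import Mathlib

/-- The formal power series `sec u = 1 / cos u` over `ℚ`. -/
noncomputable def secSeries : PowerSeries ℚ := (PowerSeries.cos ℚ)⁻¹

/-- The formal power series `tan u = sin u / cos u` over `ℚ`. -/
noncomputable def tanSeries : PowerSeries ℚ := PowerSeries.sin ℚ * (PowerSeries.cos ℚ)⁻¹

/-- `E_m`, defined by `sec u = ∑ E_m u ^ m / m!`; for even `m` these are the secant numbers. -/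
noncomputable def secantNumber (m : ℕ) : ℚ := (m.factorial : ℚ) * PowerSeries.coeff m secSeries

/-- `T_m`, defined by `tan u = ∑ T_m u ^ m / m!`; for odd `m` these are the tangent numbers. -/
noncomputable def tangentNumber (m : ℕ) : ℚ := (m.factorial : ℚ) * PowerSeries.coeff m tanSeries

/-- The sum of the `n`-th row `f_n(1), …, f_n(2n-1)` of a triangular array (`n ≥ 1`). -/
def rowSum (f : ℕ → ℕ → ℚ) (n : ℕ) : ℚ := ∑ k ∈ Finset.Icc 1 (2 * n - 1), f n k

/-- The finite difference equation system `Δ² f_n(k) + 4 f_{n-1}(k) = 0`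
for `n ≥ 2`, `1 ≤ k ≤ 2n-3`, where `Δ f_n(k) = f_n(k+1) - f_n(k)`.
An array `f_n(k)` (`n ≥ 1`, `1 ≤ k ≤ 2n-1`) is a function `f : ℕ → ℕ → ℚ`,
whose values elsewhere play no role. -/
def SatisfiesSystem (f : ℕ → ℕ → ℚ) : Prop :=
  ∀ n k : ℕ, 2 ≤ n → 1 ≤ k → k ≤ 2 * n - 3 →
    (fwdDiff (1 : ℕ))^[2] (f n) k + 4 * f (n - 1) k = 0

/-- `f` is the triangle `g_n(k)`: the solution of the system with the initial values
`f_1(1) = 1`, `f_n(1) = 0` and `f_n(2) = 2 ∑_k f_{n-1}(k)` for `n ≥ 2`. -/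
structure IsTangentTriangle (f : ℕ → ℕ → ℚ) : Prop where
  system : SatisfiesSystem f
  one_one : f 1 1 = 1
  first : ∀ n : ℕ, 2 ≤ n → f n 1 = 0
  second : ∀ n : ℕ, 2 ≤ n → f n 2 = 2 * rowSum f (n - 1)

/-- `f` is the triangle `h_n(k)`: the solution of the system with the initial values
`f_1(1) = 1`, `f_n(1) = ∑_k f_{n-1}(k)` and `f_n(2) = 3 ∑_k f_{n-1}(k)` for `n ≥ 2`. -/
structure IsSecantTriangle (f : ℕ → ℕ → ℚ) : Prop where
  system : SatisfiesSystem f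
  one_one : f 1 1 = 1
  first : ∀ n : ℕ, 2 ≤ n → f n 1 = rowSum f (n - 1)
  second : ∀ n : ℕ, 2 ≤ n → f n 2 = 3 * rowSum f (n - 1)

/-! The two triangles exist, and their entries are uniquely determined. -/

/-- The row with first entries `a`, `b` that the system produces from the row `p` above it. -/
def nextRow (p : ℕ → ℚ) (a b : ℚ) : ℕ → ℚ
  | 0 => 0
  | 1 => a
  | 2 => b
  | k + 3 => 2 * nextRow p a b (k + 2) - nextRow p a b (k + 1) - 4 * p (k + 1)

/-- The solution of the system with `f_1(1) = 1` and, for `n ≥ 2`,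
`f_n(1) = a ∑_k f_{n-1}(k)` and `f_n(2) = b ∑_k f_{n-1}(k)`. -/
def solution (a b : ℚ) : ℕ → ℕ → ℚ
  | 0 => fun _ => 0
  | 1 => fun _ => 1
  | n + 2 =>
      nextRow (solution a b (n + 1))
        (a * ∑ k ∈ Finset.Icc 1 (2 * (n + 1) - 1), solution a b (n + 1) k)
        (b * ∑ k ∈ Finset.Icc 1 (2 * (n + 1) - 1), solution a b (n + 1) k)

theorem fwdDiff_two_eq (f : ℕ → ℚ) (k : ℕ) :
    (fwdDiff (1 : ℕ))^[2] f k = f (k + 2) - 2 * f (k + 1) + f k := by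
  simp only [Function.iterate_succ, Function.iterate_zero, Function.comp, id, fwdDiff]
  ring

theorem satisfiesSystem_solution (a b : ℚ) : SatisfiesSystem (solution a b) := by
  intro n k hn hk _
  obtain ⟨n, rfl⟩ := Nat.exists_eq_add_of_le' hn
  obtain ⟨k, rfl⟩ := Nat.exists_eq_add_of_le' hk
  rw [fwdDiff_two_eq]
  simp only [solution, nextRow, Nat.add_succ_sub_one]
  ring

theorem isTangentTriangle_solution : IsTangentTriangle (solution 0 2) where
  system := satisfiesSystem_solution 0 2
  one_one := by simp [solution]
  first n hn := by
    obtain ⟨n, rfl⟩ := Nat.exists_eq_add_of_le' hn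
    simp [solution, nextRow]
  second n hn := by
    obtain ⟨n, rfl⟩ := Nat.exists_eq_add_of_le' hn
    simp [solution, nextRow, rowSum]

theorem isSecantTriangle_solution : IsSecantTriangle (solution 1 3) where
  system := satisfiesSystem_solution 1 3
  one_one := by simp [solution]
  first n hn := by
    obtain ⟨n, rfl⟩ := Nat.exists_eq_add_of_le' hn
    simp [solution, nextRow, rowSum]
  second n hn := by
    obtain ⟨n, rfl⟩ := Nat.exists_eq_add_of_le' hn
    simp [solution, nextRow, rowSum]

theorem eq_solution {f : ℕ → ℕ → ℚ} {a b : ℚ} (hs : SatisfiesSystem f) (h1 : f 1 1 = 1)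
    (ha : ∀ n : ℕ, 2 ≤ n → f n 1 = a * rowSum f (n - 1))
    (hb : ∀ n : ℕ, 2 ≤ n → f n 2 = b * rowSum f (n - 1)) (n : ℕ) (hn : 1 ≤ n) :
    ∀ k : ℕ, 1 ≤ k → k ≤ 2 * n - 1 → f n k = solution a b n k := by
  induction n, hn using Nat.le_induction with
  | base =>
    intro k hk hk'
    obtain rfl : k = 1 := by omega
    simpa [solution] using h1
  | succ n hn ih =>
    obtain ⟨n, rfl⟩ := Nat.exists_eq_add_of_le' hn
    have hsum : rowSum f (n + 1)
        = ∑ k ∈ Finset.Icc 1 (2 * (n + 1) - 1), solution a b (n + 1) k :=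
      Finset.sum_congr rfl fun k hk => ih k (Finset.mem_Icc.1 hk).1 (Finset.mem_Icc.1 hk).2
    intro k
    induction k using Nat.strong_induction_on with
    | _ k ihk =>
      intro hk hk'
      match k, hk with
      | 1, _ => simpa [solution, nextRow, hsum] using ha (n + 2) (by omega)
      | 2, _ => simpa [solution, nextRow, hsum] using hb (n + 2) (by omega)
      | k + 3, _ =>
        have e := hs (n + 2) (k + 1) (by omega) (by omega) (by omega)
        have e' := satisfiesSystem_solution a b (n + 2) (k + 1) (by omega) (by omega) (by omega)
        rw [fwdDiff_two_eq] at e e'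
        have i1 := ihk (k + 1) (by omega) (by omega) (by omega)
        have i2 := ihk (k + 2) (by omega) (by omega) (by omega)
        have i3 := ih (k + 1) (by omega) (by omega)
        simp only [Nat.add_succ_sub_one, add_assoc, Nat.reduceAdd] at *
        linarith

theorem IsTangentTriangle.eq_solution {f : ℕ → ℕ → ℚ} (h : IsTangentTriangle f) (n k : ℕ)
    (hn : 1 ≤ n) (hk : 1 ≤ k) (hk' : k ≤ 2 * n - 1) : f n k = solution 0 2 n k :=
  _root_.eq_solution h.system h.one_one (by simpa using h.first) h.second n hn k hk hk'

theorem IsSecantTriangle.eq_solution {f : ℕ → ℕ → ℚ} (h : IsSecantTriangle f) (n k : ℕ)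
    (hn : 1 ≤ n) (hk : 1 ≤ k) (hk' : k ≤ 2 * n - 1) : f n k = solution 1 3 n k :=
  _root_.eq_solution h.system h.one_one (by simpa using h.first) h.second n hn k hk hk'

/-! Both triangles are arrays of Taylor coefficients of `A(x + y) cos(x - y)`, with `A = sec` for
`g` and `A = sec²` for `h`. As this is the real part of `A(x + y) e^{i(x - y)}`, `∂/∂x` and `∂/∂y`
act on `A` as `D + i` and `D - i` with `D = d/du`, so every claim about the array becomes an
identity between polynomials in `D`.

The operators differ by `2i`, and `(2i)² = -4` gives the system (`satisfiesSystem_cosTriangle`).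
Conjugation makes the rows symmetric, so row sums reduce to first and second entries
(`SatisfiesSystem.two_mul_rowSum`). The initial values then follow from `sec · cos = 1` for `g`, and
from `sec² · cos = sec`, `sec² · sin = sec'` for `h`; uniqueness identifies the arrays.

By the binomial theorem the two weighted sums apply `(2D)^(2n)` and `(2i)^(2n) = (-4)^n` to `A` at
`0`. The first gives `4^n` times the `2n`-th derivative of `A`, where `sec² = tan'` produces the
tangent numbers; the second gives `(-4)^n A(0)`. -/

open Polynomial in
/-- The additive functional on `ℤ[i][X]` with `c X ^ m ↦ m! [u ^ m] A * re c`. It is the real part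
of the value at `0` of the differential operator `P(d/du)` applied to `A`. -/
noncomputable def derivEval (A : PowerSeries ℚ) : GaussianInt[X] →+ ℚ where
  toFun P := P.sum fun m c => (m.factorial : ℚ) * PowerSeries.coeff m A * (c.re : ℚ)
  map_zero' := by simp
  map_add' P Q := by
    apply Polynomial.sum_add_index
    · simp
    · intro a b c
      simp [mul_add]

/-- The imaginary unit of `ℤ[i]`. -/
def GaussianInt.imUnit : GaussianInt := ⟨0, 1⟩

open Polynomial GaussianInt

/-! ### Differential operators with Gaussian coefficients -/

theorem derivEval_C_mul_X_pow (A : PowerSeries ℚ) (c : GaussianInt) (m : ℕ) :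
    derivEval A (C c * X ^ m) = (m.factorial : ℚ) * PowerSeries.coeff m A * (c.re : ℚ) := by
  rw [C_mul_X_pow_eq_monomial]
  exact sum_monomial_index c
    (fun m c => (m.factorial : ℚ) * PowerSeries.coeff m A * (c.re : ℚ)) (by simp)

theorem derivEval_map_star (A : PowerSeries ℚ) (P : GaussianInt[X]) :
    derivEval A (P.map (starRingEnd GaussianInt)) = derivEval A P := by
  induction P using Polynomial.induction_on' with
  | add P Q hP hQ => rw [Polynomial.map_add, map_add, map_add, hP, hQ]
  | monomial m c =>
    rw [← C_mul_X_pow_eq_monomial, Polynomial.map_mul, Polynomial.map_pow, map_C, map_X,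
      derivEval_C_mul_X_pow, derivEval_C_mul_X_pow, starRingEnd_apply, Zsqrtd.re_star]

theorem GaussianInt.imUnit_sq : imUnit ^ 2 = -1 := by
  decide

theorem GaussianInt.star_imUnit : starRingEnd GaussianInt imUnit = -imUnit := by
  decide

theorem GaussianInt.imUnit_pow_even (j : ℕ) : imUnit ^ (2 * j) = ((-1 : ℤ) ^ j : ℤ) := by
  rw [pow_mul, imUnit_sq]
  push_cast
  rfl

theorem GaussianInt.imUnit_pow_odd (j : ℕ) :
    imUnit ^ (2 * j + 1) = ((-1 : ℤ) ^ j : ℤ) * imUnit := by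
  rw [pow_succ, imUnit_pow_even]

theorem GaussianInt.re_imUnit_pow (s : ℕ) :
    ((imUnit ^ s).re : ℚ) = s.factorial * PowerSeries.coeff s (PowerSeries.cos ℚ) := by
  have hs : (s.factorial : ℚ) ≠ 0 := by positivity
  obtain ⟨j, rfl | rfl⟩ := Nat.even_or_odd' s
  · rw [imUnit_pow_even, Zsqrtd.re_intCast]
    simp [PowerSeries.cos, mul_div_cancel₀ _ hs]
  · rw [imUnit_pow_odd, Zsqrtd.re_mul, Zsqrtd.im_intCast]
    simp [PowerSeries.cos, imUnit]

theorem GaussianInt.re_imUnit_mul_pow (s : ℕ) :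
    ((imUnit * imUnit ^ s).re : ℚ)
      = -(s.factorial * PowerSeries.coeff s (PowerSeries.sin ℚ)) := by
  have hs : (s.factorial : ℚ) ≠ 0 := by positivity
  rw [← pow_succ']
  obtain ⟨j, rfl | rfl⟩ := Nat.even_or_odd' s
  · rw [imUnit_pow_odd, Zsqrtd.re_mul, Zsqrtd.im_intCast]
    simp [PowerSeries.sin, imUnit]
  · rw [show 2 * j + 1 + 1 = 2 * (j + 1) by ring, imUnit_pow_even, Zsqrtd.re_intCast]
    have hj : (2 * j + 1) / 2 = j := by omega
    simp [PowerSeries.sin, mul_div_cancel₀ _ hs, pow_succ, hj]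

/-- Exponential shift: `(D + c)^m A` at `0` is the `m`-th derivative of `A(u) e^{cu}` at `0`. The
hypothesis says that `B` is the real part of `w e^{cu}`. -/
theorem derivEval_C_mul_X_add_C_pow (A B : PowerSeries ℚ) (w c : GaussianInt)
    (h : ∀ s : ℕ, ((w * c ^ s).re : ℚ) = s.factorial * PowerSeries.coeff s B) (m : ℕ) :
    derivEval A (C w * (X + C c) ^ m) = m.factorial * PowerSeries.coeff m (A * B) := by
  rw [(Commute.all (X : GaussianInt[X]) (C c)).add_pow', Finset.mul_sum, map_sum,
    PowerSeries.coeff_mul, Finset.mul_sum]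
  refine Finset.sum_congr rfl fun p hp => ?_
  obtain rfl := Finset.HasAntidiagonal.mem_antidiagonal.1 hp
  have e : C w * ((p.1 + p.2).choose p.1 • ((X : GaussianInt[X]) ^ p.1 * C c ^ p.2))
      = (p.1 + p.2).choose p.1 • (C (w * c ^ p.2) * X ^ p.1) := by
    rw [C_mul, C_pow, mul_smul_comm]
    ring_nf
  rw [e, map_nsmul, derivEval_C_mul_X_pow, h, ← Nat.add_choose_mul_factorial_mul_factorial,
    Nat.choose_symm_add]
  push_cast
  rw [nsmul_eq_mul]
  ring

theorem derivEval_X_add_C_imUnit_pow (A : PowerSeries ℚ) (m : ℕ) :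
    derivEval A ((X + C imUnit) ^ m)
      = m.factorial * PowerSeries.coeff m (A * PowerSeries.cos ℚ) := by
  simpa using derivEval_C_mul_X_add_C_pow A (PowerSeries.cos ℚ) 1 imUnit
    (by simpa using re_imUnit_pow) m

theorem derivEval_C_imUnit_mul_X_add_C_imUnit_pow (A : PowerSeries ℚ) (m : ℕ) :
    derivEval A (C imUnit * (X + C imUnit) ^ m)
      = -(m.factorial * PowerSeries.coeff m (A * PowerSeries.sin ℚ)) := by
  simpa using derivEval_C_mul_X_add_C_pow A (-PowerSeries.sin ℚ) imUnit imUnit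
    (fun s => by rw [re_imUnit_mul_pow]; simp) m

/-! ### The array of `A(x + y) cos(x - y)` -/

/-- The triangular array whose entry in row `n`, position `k` is
`(∂/∂x) ^ (2n-1-k) (∂/∂y) ^ (k-1)` of `A(x + y) cos(x - y)` at the origin. -/
noncomputable def cosTriangle (A : PowerSeries ℚ) (n k : ℕ) : ℚ :=
  derivEval A ((X + C imUnit) ^ (2 * n - 1 - k) * (X - C imUnit) ^ (k - 1))

theorem C_imUnit_sq : (C imUnit : GaussianInt[X]) ^ 2 = -1 := by
  rw [← C_pow, imUnit_sq, C_neg, C_1]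

theorem satisfiesSystem_cosTriangle (A : PowerSeries ℚ) : SatisfiesSystem (cosTriangle A) := by
  intro n k hn hk hkn
  obtain ⟨k, rfl⟩ := Nat.exists_eq_add_of_le' hk
  obtain ⟨j, hj⟩ : ∃ j, 2 * n - 3 = k + 1 + j := ⟨2 * n - 3 - (k + 1), by omega⟩
  rw [fwdDiff_two_eq]
  unfold cosTriangle
  rw [show 2 * n - 1 - (k + 1 + 2) = j by omega, show 2 * n - 1 - (k + 1 + 1) = j + 1 by omega,
    show 2 * n - 1 - (k + 1) = j + 2 by omega, show 2 * (n - 1) - 1 - (k + 1) = j by omega,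
    show k + 1 + 2 - 1 = k + 2 by omega, show k + 1 + 1 - 1 = k + 1 by omega,
    show k + 1 - 1 = k by omega]
  set P : GaussianInt[X] := X + C imUnit with hP
  set Q : GaussianInt[X] := X - C imUnit with hQ
  have e : P ^ j * Q ^ (k + 2) - 2 • (P ^ (j + 1) * Q ^ (k + 1)) + P ^ (j + 2) * Q ^ k
      + 4 • (P ^ j * Q ^ k) = 0 := by
    -- `Q - P = -2i`.
    have : (Q - P) ^ 2 + 4 = 0 := by
      rw [hP, hQ]
      linear_combination 4 * C_imUnit_sq
    simp only [nsmul_eq_mul]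
    push_cast
    linear_combination P ^ j * Q ^ k * this
  have := congrArg (derivEval A) e
  rw [map_add, map_add, map_sub, map_nsmul, map_nsmul, map_zero] at this
  simpa using this

/-- Conjugation swaps `X + i` and `X - i` and leaves the real part unchanged. -/
theorem cosTriangle_symm (A : PowerSeries ℚ) {n k : ℕ} (hk : 1 ≤ k) (hkn : k ≤ 2 * n - 1) :
    cosTriangle A n (2 * n - k) = cosTriangle A n k := by
  unfold cosTriangle
  rw [← derivEval_map_star]
  simp only [Polynomial.map_mul, Polynomial.map_pow, Polynomial.map_add, Polynomial.map_sub,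
    map_X, map_C, star_imUnit, C_neg]
  rw [show 2 * n - 1 - (2 * n - k) = k - 1 by omega, show 2 * n - k - 1 = 2 * n - 1 - k by omega,
    sub_neg_eq_add, ← sub_eq_add_neg, mul_comm]

theorem sum_Icc_second_difference (u : ℕ → ℚ) (m : ℕ) :
    ∑ k ∈ Finset.Icc 1 m, (u (k + 2) - 2 * u (k + 1) + u k)
      = (u (m + 2) - u (m + 1)) - (u 2 - u 1) := by
  induction m with
  | zero => simp
  | succ m ih =>
    rw [Finset.sum_Icc_succ_top (by omega), ih]
    ring

/-- In a solution with symmetric rows, the row sums are given by the first two entries of the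
next row. -/
theorem SatisfiesSystem.two_mul_rowSum {f : ℕ → ℕ → ℚ} (hf : SatisfiesSystem f) {n : ℕ}
    (hn : 2 ≤ n) (hsymm : ∀ k, 1 ≤ k → k ≤ 2 * n - 1 → f n (2 * n - k) = f n k) :
    2 * rowSum f (n - 1) = f n 2 - f n 1 := by
  have e : ∑ k ∈ Finset.Icc 1 (2 * n - 3), (f n (k + 2) - 2 * f n (k + 1) + f n k)
      = -4 * rowSum f (n - 1) := by
    rw [rowSum, Finset.mul_sum, show 2 * (n - 1) - 1 = 2 * n - 3 by omega]
    refine Finset.sum_congr rfl fun k hk => ?_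
    obtain ⟨hk, hk'⟩ := Finset.mem_Icc.1 hk
    have := hf n k hn hk hk'
    rw [fwdDiff_two_eq] at this
    linarith
  -- The sum telescopes to the last difference of the row minus the first; by symmetry these are
  -- opposite.
  rw [sum_Icc_second_difference] at e
  have h1 := hsymm 1 le_rfl (by omega)
  have h2 := hsymm 2 (by omega) (by omega)
  rw [show 2 * n - 3 + 2 = 2 * n - 1 by omega, show 2 * n - 3 + 1 = 2 * n - 2 by omega, h1, h2] at e
  linarith

theorem cosTriangle_two_mul_rowSum (A : PowerSeries ℚ) {n : ℕ} (hn : 2 ≤ n) :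
    2 * rowSum (cosTriangle A) (n - 1) = cosTriangle A n 2 - cosTriangle A n 1 :=
  (satisfiesSystem_cosTriangle A).two_mul_rowSum hn fun _ => cosTriangle_symm A

theorem cosTriangle_one_one (A : PowerSeries ℚ) :
    cosTriangle A 1 1 = PowerSeries.coeff 0 A := by
  simpa [cosTriangle] using derivEval_C_mul_X_pow A 1 0

theorem cosTriangle_first (A : PowerSeries ℚ) (n : ℕ) :
    cosTriangle A (n + 1) 1
      = (2 * n).factorial * PowerSeries.coeff (2 * n) (A * PowerSeries.cos ℚ) := by
  rw [← derivEval_X_add_C_imUnit_pow, cosTriangle, Nat.sub_self, pow_zero, mul_one,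
    show 2 * (n + 1) - 1 - 1 = 2 * n by omega]

theorem cosTriangle_second (A : PowerSeries ℚ) (n : ℕ) :
    cosTriangle A (n + 2) 2 = cosTriangle A (n + 2) 1
      + 2 * ((2 * n + 1).factorial
        * PowerSeries.coeff (2 * n + 1) (A * PowerSeries.sin ℚ)) := by
  have e : (X + C imUnit) ^ (2 * n + 1) * (X - C imUnit)
      = (X + C imUnit) ^ (2 * n + 2) - 2 • (C imUnit * (X + C imUnit) ^ (2 * n + 1)) := by
    rw [nsmul_eq_mul]
    push_cast
    ring
  unfold cosTriangle
  rw [show 2 * (n + 2) - 1 - 2 = 2 * n + 1 by omega, show 2 * (n + 2) - 1 - 1 = 2 * n + 2 by omega,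
    show 2 - 1 = 1 from rfl, pow_one, e, map_sub, map_nsmul,
    derivEval_C_imUnit_mul_X_add_C_imUnit_pow, Nat.sub_self, pow_zero, mul_one, nsmul_eq_mul]
  push_cast
  ring

/-! ### Binomial sums along a row -/

theorem cosTriangle_sum_choose_mul_pow (A : PowerSeries ℚ) (n : ℕ) (z : ℤ) :
    ∑ k ∈ Finset.Icc 1 (2 * n + 1),
        (z : ℚ) ^ (k - 1) * ((2 * n).choose (k - 1) : ℚ) * cosTriangle A (n + 1) k
      = derivEval A ((X + C imUnit + (z : GaussianInt[X]) * (X - C imUnit)) ^ (2 * n)) := by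
  rw [add_comm (X + C imUnit), add_pow, map_sum, ← Finset.Ico_add_one_right_eq_Icc,
    Finset.sum_Ico_eq_sum_range, Nat.add_sub_cancel]
  refine Finset.sum_congr rfl fun k _ => ?_
  have e : ((z : GaussianInt[X]) * (X - C imUnit)) ^ k * (X + C imUnit) ^ (2 * n - k)
        * ((2 * n).choose k : GaussianInt[X])
      = (z ^ k * ((2 * n).choose k : ℤ))
        • ((X + C imUnit) ^ (2 * n - k) * (X - C imUnit) ^ k) := by
    rw [zsmul_eq_mul, mul_pow]
    push_cast
    ring
  rw [e, map_zsmul, cosTriangle, Nat.add_sub_cancel_left,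
    show 2 * (n + 1) - 1 - (1 + k) = 2 * n - k by omega, zsmul_eq_mul]
  push_cast
  rfl

theorem cosTriangle_sum_choose (A : PowerSeries ℚ) (n : ℕ) :
    ∑ k ∈ Finset.Icc 1 (2 * n + 1), ((2 * n).choose (k - 1) : ℚ) * cosTriangle A (n + 1) k
      = 4 ^ n * ((2 * n).factorial * PowerSeries.coeff (2 * n) A) := by
  have h := cosTriangle_sum_choose_mul_pow A n 1
  have e : (X + C imUnit + ((1 : ℤ) : GaussianInt[X]) * (X - C imUnit)) ^ (2 * n)
      = 4 ^ n • (C 1 * X ^ (2 * n)) := by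
    rw [nsmul_eq_mul, pow_mul X, pow_mul]
    push_cast
    rw [C_1, one_mul, one_mul, ← mul_pow]
    congr 1
    ring
  rw [e, map_nsmul, derivEval_C_mul_X_pow] at h
  simpa using h

theorem cosTriangle_sum_neg_one_pow_choose (A : PowerSeries ℚ) (n : ℕ) :
    ∑ k ∈ Finset.Icc 1 (2 * n + 1),
        (-1) ^ (k - 1) * ((2 * n).choose (k - 1) : ℚ) * cosTriangle A (n + 1) k
      = (-1) ^ n * 4 ^ n * PowerSeries.coeff 0 A := by
  have h := cosTriangle_sum_choose_mul_pow A n (-1)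
  have e : (X + C imUnit + ((-1 : ℤ) : GaussianInt[X]) * (X - C imUnit)) ^ (2 * n)
      = ((-1 : ℤ) ^ n * 4 ^ n) • (C 1 * X ^ 0) := by
    rw [zsmul_eq_mul, pow_mul]
    push_cast
    rw [C_1, pow_zero, mul_one, mul_one, ← mul_pow]
    congr 1
    linear_combination 4 * C_imUnit_sq
  rw [e, map_zsmul, derivEval_C_mul_X_pow] at h
  simpa using h

/-! ### Power series identities for sec and tan -/

theorem constantCoeff_cos : PowerSeries.constantCoeff (PowerSeries.cos ℚ) = 1 := by
  rw [← PowerSeries.coeff_zero_eq_constantCoeff_apply, PowerSeries.cos, PowerSeries.coeff_mk]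
  simp

theorem constantCoeff_sin : PowerSeries.constantCoeff (PowerSeries.sin ℚ) = 0 := by
  rw [← PowerSeries.coeff_zero_eq_constantCoeff_apply, PowerSeries.sin, PowerSeries.coeff_mk]
  simp

theorem secSeries_mul_cos : secSeries * PowerSeries.cos ℚ = 1 :=
  PowerSeries.inv_mul_cancel _ (by rw [constantCoeff_cos]; exact one_ne_zero)

theorem coeff_zero_secSeries : PowerSeries.coeff 0 secSeries = 1 := by
  rw [PowerSeries.coeff_zero_eq_constantCoeff_apply, secSeries, PowerSeries.constantCoeff_inv,
    constantCoeff_cos, inv_one]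

theorem coeff_zero_secSeries_sq : PowerSeries.coeff 0 (secSeries ^ 2) = 1 := by
  rw [PowerSeries.coeff_zero_eq_constantCoeff_apply, map_pow,
    ← PowerSeries.coeff_zero_eq_constantCoeff_apply, coeff_zero_secSeries, one_pow]

open PowerSeries (derivative)

theorem derivative_sin : derivative ℚ (PowerSeries.sin ℚ) = PowerSeries.cos ℚ := by
  ext n
  rw [PowerSeries.coeff_derivative]
  have hn : (n.factorial : ℚ) ≠ 0 := by positivity
  obtain ⟨j, rfl | rfl⟩ := Nat.even_or_odd' n
  · have hj : (2 * j + 1) / 2 = j := by omega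
    simp [PowerSeries.sin, PowerSeries.cos, hj, Nat.factorial_succ]
    field_simp
  · simp [PowerSeries.sin, PowerSeries.cos, parity_simps]

theorem derivative_cos : derivative ℚ (PowerSeries.cos ℚ) = -PowerSeries.sin ℚ := by
  ext n
  rw [PowerSeries.coeff_derivative]
  have hn : (n.factorial : ℚ) ≠ 0 := by positivity
  obtain ⟨j, rfl | rfl⟩ := Nat.even_or_odd' n
  · simp [PowerSeries.sin, PowerSeries.cos, parity_simps]
  · have hj : (2 * j + 1) / 2 = j := by omega
    have hj' : (2 * j + 1 + 1) / 2 = j + 1 := by omega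
    have he : Even (2 * j + 1 + 1) := ⟨j + 1, by ring⟩
    simp [PowerSeries.sin, PowerSeries.cos, hj, hj', he, Nat.factorial_succ, pow_succ]
    field_simp

theorem cos_sq_add_sin_sq : PowerSeries.cos ℚ ^ 2 + PowerSeries.sin ℚ ^ 2 = 1 := by
  apply PowerSeries.derivative.ext
  · rw [map_add, PowerSeries.derivative_pow, PowerSeries.derivative_pow, derivative_sin,
      derivative_cos, PowerSeries.derivative_one]
    push_cast
    ring
  · simp [constantCoeff_cos, constantCoeff_sin]

theorem derivative_secSeries :
    derivative ℚ secSeries = secSeries ^ 2 * PowerSeries.sin ℚ := by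
  rw [secSeries, PowerSeries.derivative_inv', derivative_cos]
  ring

theorem derivative_tanSeries : derivative ℚ tanSeries = secSeries ^ 2 := by
  have h : tanSeries = PowerSeries.sin ℚ * secSeries := rfl
  rw [h, Derivation.leibniz, derivative_sin, derivative_secSeries, smul_eq_mul, smul_eq_mul]
  linear_combination secSeries ^ 2 * cos_sq_add_sin_sq
    - secSeries * PowerSeries.cos ℚ * secSeries_mul_cos

/-! ### Identification of the two triangles -/

theorem isTangentTriangle_cosTriangle : IsTangentTriangle (cosTriangle secSeries) := by
  have first : ∀ n : ℕ, 2 ≤ n → cosTriangle secSeries n 1 = 0 := by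
    intro n hn
    obtain ⟨n, rfl⟩ := Nat.exists_eq_add_of_le' hn
    rw [cosTriangle_first, secSeries_mul_cos, PowerSeries.coeff_one, if_neg (by omega), mul_zero]
  refine ⟨satisfiesSystem_cosTriangle _, ?_, first, fun n hn => ?_⟩
  · rw [cosTriangle_one_one, coeff_zero_secSeries]
  · rw [cosTriangle_two_mul_rowSum _ hn, first n hn, sub_zero]

theorem isSecantTriangle_cosTriangle : IsSecantTriangle (cosTriangle (secSeries ^ 2)) := by
  have second : ∀ n : ℕ, 2 ≤ n →
      cosTriangle (secSeries ^ 2) n 2 = 3 * cosTriangle (secSeries ^ 2) n 1 := by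
    intro n hn
    obtain ⟨n, rfl⟩ := Nat.exists_eq_add_of_le' hn
    -- Since `sec² · sin = sec'` and `sec² · cos = sec`, the increment from the first entry to the
    -- second is twice the first entry.
    rw [cosTriangle_second, cosTriangle_first, ← derivative_secSeries,
      PowerSeries.coeff_derivative, pow_two, mul_assoc, secSeries_mul_cos, mul_one,
      show 2 * (n + 1) = 2 * n + 1 + 1 by ring, Nat.factorial_succ (2 * n + 1)]
    push_cast
    ring
  refine ⟨satisfiesSystem_cosTriangle _, ?_, fun n hn => ?_, fun n hn => ?_⟩
  · rw [cosTriangle_one_one, coeff_zero_secSeries_sq]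
  all_goals
    have h1 := cosTriangle_two_mul_rowSum (secSeries ^ 2) hn
    have h2 := second n hn
    linarith

theorem factorial_mul_coeff_secSeries_sq (m : ℕ) :
    (m.factorial : ℚ) * PowerSeries.coeff m (secSeries ^ 2) = tangentNumber (m + 1) := by
  rw [← derivative_tanSeries, PowerSeries.coeff_derivative, tangentNumber, Nat.factorial_succ]
  push_cast
  ring

theorem mainTheorem9 (g h : ℕ → ℕ → ℚ) (hg : IsTangentTriangle g) (hh : IsSecantTriangle h)
    (n : ℕ) (hn : 1 ≤ n) :
    (∑ k ∈ Finset.Icc 1 (2 * n + 1), ((2 * n).choose (k - 1) : ℚ) * g (n + 1) k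
        = 4 ^ n * secantNumber (2 * n)) ∧
    (∑ k ∈ Finset.Icc 1 (2 * n + 1), (-1) ^ (k - 1) * ((2 * n).choose (k - 1) : ℚ) * g (n + 1) k
        = (-1) ^ n * 4 ^ n) ∧
    (∑ k ∈ Finset.Icc 1 (2 * n + 1), ((2 * n).choose (k - 1) : ℚ) * h (n + 1) k
        = 4 ^ n * tangentNumber (2 * n + 1)) ∧
    (∑ k ∈ Finset.Icc 1 (2 * n + 1), (-1) ^ (k - 1) * ((2 * n).choose (k - 1) : ℚ) * h (n + 1) k
        = (-1) ^ n * 4 ^ n) := by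
  have hg' : ∀ k ∈ Finset.Icc 1 (2 * n + 1), g (n + 1) k = cosTriangle secSeries (n + 1) k := by
    intro k hk
    obtain ⟨hk, hk'⟩ := Finset.mem_Icc.1 hk
    rw [hg.eq_solution (n + 1) k (by omega) hk (by omega),
      isTangentTriangle_cosTriangle.eq_solution (n + 1) k (by omega) hk (by omega)]
  have hh' : ∀ k ∈ Finset.Icc 1 (2 * n + 1),
      h (n + 1) k = cosTriangle (secSeries ^ 2) (n + 1) k := by
    intro k hk
    obtain ⟨hk, hk'⟩ := Finset.mem_Icc.1 hk
    rw [hh.eq_solution (n + 1) k (by omega) hk (by omega),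
      isSecantTriangle_cosTriangle.eq_solution (n + 1) k (by omega) hk (by omega)]
  refine ⟨?_, ?_, ?_, ?_⟩
  · rw [Finset.sum_congr rfl fun k hk => by rw [hg' k hk], cosTriangle_sum_choose, secantNumber]
  · rw [Finset.sum_congr rfl fun k hk => by rw [hg' k hk], cosTriangle_sum_neg_one_pow_choose,
      coeff_zero_secSeries, mul_one]
  · rw [Finset.sum_congr rfl fun k hk => by rw [hh' k hk], cosTriangle_sum_choose,
      factorial_mul_coeff_secSeries_sq]
  · rw [Finset.sum_congr rfl fun k hk => by rw [hh' k hk], cosTriangle_sum_neg_one_pow_choose,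
      coeff_zero_secSeries_sq, mul_one]
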